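/- Let $k$ be a field of arbitrary characteristic; all tensor products are over $k$. Let $B$ be a Poisson Hopf algebra over $k$, i.e. a commutative Hopf algebra with a Poisson bracket $\{\cdot,\cdot\}$ such that $\Delta(\{a,b\})=\{\Delta(a),\Delta(b)\}$, where $\{a\otimes b,c\otimes d\}=ac\otimes\{b,d\}+\{a,c\}\otimes bd$ on $B\otimes B$. Assume that $B$ is pointed, i.e. its coradical (the sum of all simple subcoalgebras) is spanned by the group-like elements. Let $B^e$ be the universal enveloping algebra of the Poisson algebra $B$: the unital associative $k$-algebra generated by two copies $\{m_a\}_{a\in B}$ and $\{h_a\}_{a\in B}$ of the vector space $B$ with relations $$m_{xy}=m_xm_y,\quad h_{\{x,y\}}=h_xh_y-h_yh_x,\quad h_{xy}=m_yh_x+m_xh_y,\quad m_{\{x,y\}}=h_xm_y-m_yh_x,\quad m_1=1 .$$ It is a bialgebra (indeed a Hopf algebra) with $\Delta m=(m\otimes m)\Delta$, $\Delta h=(m\otimes h+h\otimes m)\Delta$, $\varepsilon m=\varepsilon$, $\varepsilon h=0$. Let $B^+=\ker\varepsilon\subset B$. The left ideal $B^eB^+$ of $B^e$ generated by $m(B^+)$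 is a two-sided ideal and a coideal; let $\mathcal H(B)=B^e/B^eB^+$ be the quotient, $\pi:B^e\to\mathcal H(B)$ the projection, and $\lambda=(\mathrm{id}\otimes\pi)\Delta:B^e\to B^e\otimes\mathcal H(B)$ the resulting right coaction. The algebra $B^e$ acts on $B$ by $m_a\cdot b=ab$, $h_a\cdot b=\{a,b\}$, on $\mathcal H(B)$ by left multiplication through $\pi$, and hence through $\Delta$ on $B\otimes\mathcal H(B)$. Let $I$ be the left ideal of $B^e$ generated by all $h_x$; then $B^e=m(B)\oplus I$. Let $\tau:I\to B\otimes\mathcal H(B)$ be the unique $B^e$-module map with $\tau(h_x)=x_1\otimes\pi(h_{x_2})$, where $\Delta(x)=x_1\otimes x_2$, and let $\Upsilon:B^e\to B\otimes\mathcal H(B)$ be the linear map with $\Upsilon(m_b)=b\otimes1$ for $b\in B$ and $\Upsilon|_I=\tau$. **Theorem.** The map $m:B\to B^e$ is an $\mathcal H(B)$-extension: $\lambda$ is an algebra map, $m$ is injective, and $m(B)=(B^e)^{\mathrm{co}\,\mathcal H(B)}=\{u\in B^e:\lambda(u)=u\otimes1\}$. This extension has the normal basis property, i.e. $B^e\cong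 B\otimes\mathcal H(B)$ as left $B$-modules and right $\mathcal H(B)$-comodules, where $B$ acts on $B^e$ by left multiplication through $m$ and on $B\otimes\mathcal H(B)$ through the left factor, and $B\otimes\mathcal H(B)$ has the coaction $\mathrm{id}\otimes\Delta$. More precisely, $\Upsilon$ is such an isomorphism: it is bijective, left $B$-linear and right $\mathcal H(B)$-colinear. -/

import Mathlib

open scoped TensorProduct

universe u v w

noncomputable section

/-! ## Poisson algebras and Poisson bialgebras -/

/-- A Poisson algebra over `k`: a commutative `k`-algebra `A` with a Lie bracket
`bracket a b = {a, b}` (bilinear, alternating, Jacobi) that is a derivation in each variable.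
Mathlib's `LieRing` is not used, since on an associative ring it already denotes the commutator. -/
class PoissonAlgebra (k : Type u) (A : Type v) [Field k] [CommRing A] [Algebra k A] where
  /-- The Poisson bracket `{a, b}`. -/
  bracket : A →ₗ[k] A →ₗ[k] A
  bracket_self : ∀ a : A, bracket a a = 0
  jacobi : ∀ a b c : A,
    bracket a (bracket b c) + bracket b (bracket c a) + bracket c (bracket a b) = 0
  leibniz : ∀ a b c : A, bracket a (b * c) = bracket a b * c + b * bracket a c

namespace PoissonAlgebra

variable (k : Type u) {A : Type v} [Field k] [CommRing A] [Algebra k A] [PoissonAlgebra k A]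

/-- The bracket on `A ⊗ A`:
`{a ⊗ b, c ⊗ d} = ac ⊗ {b, d} + {a, c} ⊗ bd`. -/
def tensorBracket (k : Type u) (A : Type v) [Field k] [CommRing A] [Algebra k A]
    [PoissonAlgebra k A] : A ⊗[k] A →ₗ[k] A ⊗[k] A →ₗ[k] A ⊗[k] A :=
  TensorProduct.map₂ (LinearMap.mul k A) bracket + TensorProduct.map₂ bracket (LinearMap.mul k A)

@[simp]
lemma tensorBracket_tmul (a b c d : A) :
    tensorBracket k A (a ⊗ₜ[k] b) (c ⊗ₜ[k] d) =
      (a * c) ⊗ₜ[k] bracket (k := k) b d + bracket (k := k) a c ⊗ₜ[k] (b * d) := by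
  simp [tensorBracket]

lemma skew (a b : A) : bracket (k := k) a b = -bracket (k := k) b a := by
  have h := bracket_self (k := k) (a + b)
  simp only [map_add, LinearMap.add_apply, bracket_self, zero_add, add_zero] at h
  exact eq_neg_of_add_eq_zero_right h

lemma leibniz_left (a b c : A) :
    bracket (k := k) (a * b) c = a * bracket (k := k) b c + b * bracket (k := k) a c := by
  rw [skew k (a * b), leibniz, skew k b c, skew k a c]
  ring

lemma bracket_bracket (a b c : A) :
    bracket (k := k) (bracket (k := k) a b) c =
      bracket (k := k) a (bracket (k := k) b c) - bracket (k := k) b (bracket (k := k) a c) := by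
  have h := jacobi (k := k) a b c
  rw [skew k c (bracket (k := k) a b), skew k c a, map_neg] at h
  linear_combination (-1 : A) * h

lemma bracket_one (a : A) : bracket (k := k) a 1 = 0 := by
  have h := leibniz (k := k) a 1 1
  simpa using h

end PoissonAlgebra

/-- A Poisson bialgebra: a commutative bialgebra with a Poisson bracket such that
`Δ {a, b} = {Δ a, Δ b}`. A Poisson Hopf algebra is a Poisson bialgebra that is a Hopf algebra. -/
class PoissonBialgebra (k : Type u) (B : Type v) [Field k] [CommRing B] [Bialgebra k B]
    extends PoissonAlgebra k B where
  comul_bracket : ∀ a b : B,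
    Coalgebra.comul (R := k) (bracket a b) =
      PoissonAlgebra.tensorBracket k B (Coalgebra.comul (R := k) a) (Coalgebra.comul (R := k) b)

namespace PoissonBialgebra

open PoissonAlgebra

variable (k : Type u) {B : Type v} [Field k] [CommRing B] [Bialgebra k B] [PoissonBialgebra k B]

/-- The counit of a Poisson bialgebra kills brackets. -/
lemma counit_bracket (a b : B) : Coalgebra.counit (R := k) (bracket (k := k) a b) = 0 := by
  let e : B →ₗ[k] k := Coalgebra.counit
  have key : ∀ x y : B ⊗[k] B,
      (TensorProduct.lid k k) (TensorProduct.map e e (tensorBracket k B x y)) =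
      e (bracket (k := k) (TensorProduct.rid k B (LinearMap.lTensor B e x))
        (TensorProduct.rid k B (LinearMap.lTensor B e y))) +
      e (bracket (k := k) (TensorProduct.lid k B (LinearMap.rTensor B e x))
        (TensorProduct.lid k B (LinearMap.rTensor B e y))) := by
    intro x y
    induction x with
    | zero => simp
    | add x₁ x₂ h₁ h₂ => simp only [map_add, LinearMap.add_apply, h₁, h₂]; ring
    | tmul p q =>
      induction y with
      | zero => simp
      | add x₁ x₂ h₁ h₂ => simp only [map_add, h₁, h₂]; ring
      | tmul r s => simp [e]; ring
  have h := key (Coalgebra.comul (R := k) a) (Coalgebra.comul (R := k) b)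
  have h2 : ∀ c : B, (TensorProduct.lid k k) (TensorProduct.map e e (Coalgebra.comul (R := k) c))
      = e c := by
    intro c
    have : TensorProduct.map e e = (LinearMap.lTensor k e) ∘ₗ (LinearMap.rTensor B e) := by
      ext; simp
    rw [this, LinearMap.comp_apply]
    simp [e]
  rw [← comul_bracket, h2] at h
  simp only [e, Coalgebra.rTensor_counit_comul, Coalgebra.lTensor_counit_comul,
    TensorProduct.rid_tmul, TensorProduct.lid_tmul, one_smul] at h
  simpa using h

end PoissonBialgebra

/-! ## Pointed coalgebras -/

namespace PointedCoalgebra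

variable (k : Type u) {C : Type v} [Field k] [AddCommGroup C] [Module k C] [Coalgebra k C]

/-- `D` is a subcoalgebra: `Δ(D) ⊆ D ⊗ D`. -/
def IsSubcoalgebra (D : Submodule k C) : Prop :=
  ∀ d ∈ D, Coalgebra.comul (R := k) d ∈ LinearMap.range (TensorProduct.map D.subtype D.subtype)

/-- A simple subcoalgebra: nonzero, with no subcoalgebras other than `0` and itself. -/
def IsSimpleSubcoalgebra (D : Submodule k C) : Prop :=
  IsSubcoalgebra k D ∧ D ≠ ⊥ ∧ ∀ D' ≤ D, IsSubcoalgebra k D' → D' = ⊥ ∨ D' = D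

variable (C)

/-- The coradical: the sum of all simple subcoalgebras. -/
def coradical : Submodule k C := sSup {D | IsSimpleSubcoalgebra k D}

/-- `C` is pointed if its coradical is spanned by the group-like elements. -/
def IsPointed : Prop := coradical k C = Submodule.span k {g : C | IsGroupLikeElem k g}

end PointedCoalgebra

/-! ## The universal enveloping algebra of a Poisson algebra -/

namespace PoissonEnv

open PoissonAlgebra

section Algebra

variable (k : Type u) (A : Type v) [Field k] [CommRing A] [Algebra k A] [PoissonAlgebra k A]

/-- The generator `m_a` in the free algebra on two copies of the vector space `A`. -/
def preM (a : A) : TensorAlgebra k (A × A) := TensorAlgebra.ι k (a, 0)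

/-- The generator `h_a` in the free algebra on two copies of the vector space `A`. -/
def preH (a : A) : TensorAlgebra k (A × A) := TensorAlgebra.ι k (0, a)

/-- The defining relations of `A^e`. -/
inductive Rel : TensorAlgebra k (A × A) → TensorAlgebra k (A × A) → Prop
  | m_mul (x y : A) : Rel (preM k A (x * y)) (preM k A x * preM k A y)
  | h_bracket (x y : A) :
      Rel (preH k A (bracket (k := k) x y)) (preH k A x * preH k A y - preH k A y * preH k A x)
  | h_mul (x y : A) :
      Rel (preH k A (x * y)) (preM k A y * preH k A x + preM k A x * preH k A y)
  | m_bracket (x y : A) :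
      Rel (preM k A (bracket (k := k) x y)) (preH k A x * preM k A y - preM k A y * preH k A x)
  | m_one : Rel (preM k A 1) 1

end Algebra

end PoissonEnv

/-- The universal enveloping algebra `A^e` of a Poisson algebra `A`: the associative algebra
generated by two copies `m_A`, `h_A` of the vector space `A` modulo the relations above. -/
def PoissonEnv (k : Type u) (A : Type v) [Field k] [CommRing A] [Algebra k A]
    [PoissonAlgebra k A] : Type (max u v) :=
  RingQuot (PoissonEnv.Rel k A)

namespace PoissonEnv

open PoissonAlgebra

section Algebra

variable (k : Type u) (A : Type v) [Field k] [CommRing A] [Algebra k A] [PoissonAlgebra k A]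

instance : Ring (PoissonEnv k A) := inferInstanceAs (Ring (RingQuot (Rel k A)))

instance : Algebra k (PoissonEnv k A) := inferInstanceAs (Algebra k (RingQuot (Rel k A)))

/-- The projection from the free algebra. -/
def mk : TensorAlgebra k (A × A) →ₐ[k] PoissonEnv k A := RingQuot.mkAlgHom k (Rel k A)

variable {k A} in
lemma mk_rel {x y : TensorAlgebra k (A × A)} (r : Rel k A x y) : mk k A x = mk k A y :=
  RingQuot.mkAlgHom_rel k r

/-- The structure map `m : A → A^e`, an algebra map. -/
def m : A →ₐ[k] PoissonEnv k A :=
  AlgHom.ofLinearMap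
    ((mk k A).toLinearMap ∘ₗ TensorAlgebra.ι k ∘ₗ LinearMap.inl k A A)
    ((mk_rel Rel.m_one).trans (map_one _))
    (fun x y => (mk_rel (Rel.m_mul x y)).trans (map_mul _ _ _))

/-- The structure map `h : A → A^e`, a linear map. -/
def h : A →ₗ[k] PoissonEnv k A :=
  (mk k A).toLinearMap ∘ₗ TensorAlgebra.ι k ∘ₗ LinearMap.inr k A A

variable {A}

lemma mk_preM (a : A) : mk k A (preM k A a) = m k A a := rfl

lemma mk_preH (a : A) : mk k A (preH k A a) = h k A a := rfl

lemma h_bracket (x y : A) :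
    h k A (bracket (k := k) x y) = h k A x * h k A y - h k A y * h k A x := by
  simpa [mk_preH] using mk_rel (Rel.h_bracket (k := k) x y)

lemma h_mul (x y : A) : h k A (x * y) = m k A y * h k A x + m k A x * h k A y := by
  simpa [mk_preH, mk_preM] using mk_rel (Rel.h_mul (k := k) x y)

lemma m_bracket (x y : A) :
    m k A (bracket (k := k) x y) = h k A x * m k A y - m k A y * h k A x := by
  simpa [mk_preH, mk_preM] using mk_rel (Rel.m_bracket (k := k) x y)

variable {k}

section Lift

variable {R : Type w} [Ring R] [Algebra k R]

/-- The universal property of `A^e`: an algebra map `f` and a linear map `g` satisfying the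
relations of `m` and `h` induce an algebra map on `A^e`. -/
def lift (f : A →ₐ[k] R) (g : A →ₗ[k] R)
    (h₁ : ∀ x y, g (bracket (k := k) x y) = g x * g y - g y * g x)
    (h₂ : ∀ x y, g (x * y) = f y * g x + f x * g y)
    (h₃ : ∀ x y, f (bracket (k := k) x y) = g x * f y - f y * g x) : PoissonEnv k A →ₐ[k] R :=
  RingQuot.liftAlgHom k ⟨TensorAlgebra.lift k (f.toLinearMap.coprod g), by
    intro x y r
    cases r <;> simp [preM, preH, h₁, h₂, h₃]⟩

@[simp]
lemma lift_m (f : A →ₐ[k] R) (g : A →ₗ[k] R) (h₁) (h₂) (h₃) (a : A) :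
    lift f g h₁ h₂ h₃ (m k A a) = f a := by
  change RingQuot.liftAlgHom k _ (RingQuot.mkAlgHom k (Rel k A) (TensorAlgebra.ι k (a, 0))) = _
  simp

@[simp]
lemma lift_h (f : A →ₐ[k] R) (g : A →ₗ[k] R) (h₁) (h₂) (h₃) (a : A) :
    lift f g h₁ h₂ h₃ (h k A a) = g a := by
  change RingQuot.liftAlgHom k _ (RingQuot.mkAlgHom k (Rel k A) (TensorAlgebra.ι k (0, a))) = _
  simp

lemma hom_ext {f g : PoissonEnv k A →ₐ[k] R} (hm : ∀ a, f (m k A a) = g (m k A a))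
    (hh : ∀ a, f (h k A a) = g (h k A a)) : f = g := by
  refine RingQuot.ringQuot_ext' (S := k) (s := Rel k A) f g ?_
  ext a
  · exact hm a
  · exact hh a

end Lift

/-- Induction principle: `A^e` is generated by the `m_a` and `h_a`. -/
lemma induction {P : PoissonEnv k A → Prop} (hm : ∀ a, P (m k A a)) (hh : ∀ a, P (h k A a))
    (hadd : ∀ x y, P x → P y → P (x + y)) (hmul : ∀ x y, P x → P y → P (x * y))
    (x : PoissonEnv k A) : P x := by
  obtain ⟨t, rfl⟩ : ∃ t, mk k A t = x := RingQuot.mkAlgHom_surjective k (Rel k A) x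
  induction t using TensorAlgebra.induction with
  | algebraMap r =>
    rw [AlgHom.commutes, ← AlgHom.commutes (m k A)]
    exact hm _
  | ι a =>
    have : TensorAlgebra.ι k a = preM k A a.1 + preH k A a.2 := by
      simp [preM, preH, ← map_add]
    rw [this, map_add, mk_preM, mk_preH]
    exact hadd _ _ (hm _) (hh _)
  | mul a b ha hb => rw [map_mul]; exact hmul _ _ ha hb
  | add a b ha hb => rw [map_add]; exact hadd _ _ ha hb

end Algebra

/-! ### The bialgebra structure on `B^e` -/

section Bialgebra

variable (k : Type u) (B : Type v) [Field k] [CommRing B] [Bialgebra k B] [PoissonBialgebra k B]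

/-- `m ⊗ m`. -/
def mm : B ⊗[k] B →ₐ[k] PoissonEnv k B ⊗[k] PoissonEnv k B :=
  Algebra.TensorProduct.map (m k B) (m k B)

/-- `m ⊗ h + h ⊗ m`. -/
def mh : B ⊗[k] B →ₗ[k] PoissonEnv k B ⊗[k] PoissonEnv k B :=
  TensorProduct.map (m k B).toLinearMap (h k B) + TensorProduct.map (h k B) (m k B).toLinearMap

variable {k B}

@[simp]
lemma mm_tmul (a b : B) : mm k B (a ⊗ₜ[k] b) = m k B a ⊗ₜ[k] m k B b := rfl

@[simp]
lemma mh_tmul (a b : B) :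
    mh k B (a ⊗ₜ[k] b) = m k B a ⊗ₜ[k] h k B b + h k B a ⊗ₜ[k] m k B b := rfl

lemma m_comm (a b : B) : m k B a * m k B b = m k B b * m k B a := by
  rw [← map_mul, ← map_mul, mul_comm]

lemma h_comm_m (a b : B) :
    h k B a * m k B b = m k B b * h k B a + m k B (bracket (k := k) a b) := by
  rw [m_bracket]; abel

lemma mh_bracket (x y : B ⊗[k] B) :
    mh k B (tensorBracket k B x y) = mh k B x * mh k B y - mh k B y * mh k B x := by
  induction x with
  | zero => simp
  | add x₁ x₂ h₁ h₂ =>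
    simp only [map_add, LinearMap.add_apply, h₁, h₂, add_mul, mul_add]; abel
  | tmul a b =>
    induction y with
    | zero => simp
    | add x₁ x₂ h₁ h₂ => simp only [map_add, h₁, h₂, add_mul, mul_add]; abel
    | tmul c d =>
      have e : ∀ p q : B, h k B q * m k B p =
          m k B p * h k B q - (h k B p * m k B q - m k B q * h k B p) := by
        intro p q
        rw [← m_bracket, skew k p q, map_neg, m_bracket]
        abel
      simp only [tensorBracket_tmul, map_add, mh_tmul, h_bracket, m_bracket, h_mul, map_mul,
        add_mul, mul_add, Algebra.TensorProduct.tmul_mul_tmul, TensorProduct.tmul_add,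
        TensorProduct.add_tmul, TensorProduct.tmul_sub, TensorProduct.sub_tmul, m_comm c a,
        m_comm d b, e a c, e b d]
      abel

lemma mh_mul (x y : B ⊗[k] B) :
    mh k B (x * y) = mm k B y * mh k B x + mm k B x * mh k B y := by
  induction x with
  | zero => simp
  | add x₁ x₂ h₁ h₂ => simp only [map_add, h₁, h₂, add_mul, mul_add]; abel
  | tmul a b =>
    induction y with
    | zero => simp
    | add x₁ x₂ h₁ h₂ => simp only [map_add, h₁, h₂, add_mul, mul_add]; abel
    | tmul c d =>
      simp only [Algebra.TensorProduct.tmul_mul_tmul, mh_tmul, mm_tmul, h_mul, map_mul, mul_add,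
        TensorProduct.tmul_add, TensorProduct.add_tmul, m_comm c a, m_comm d b]
      abel

lemma mm_bracket (x y : B ⊗[k] B) :
    mm k B (tensorBracket k B x y) = mh k B x * mm k B y - mm k B y * mh k B x := by
  induction x with
  | zero => simp
  | add x₁ x₂ h₁ h₂ =>
    simp only [map_add, LinearMap.add_apply, h₁, h₂, add_mul, mul_add]; abel
  | tmul a b =>
    induction y with
    | zero => simp
    | add x₁ x₂ h₁ h₂ => simp only [map_add, h₁, h₂, add_mul, mul_add]; abel
    | tmul c d =>
      simp only [tensorBracket_tmul, map_add, mh_tmul, mm_tmul, m_bracket, map_mul,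
        add_mul, mul_add, Algebra.TensorProduct.tmul_mul_tmul,
        TensorProduct.tmul_sub, TensorProduct.sub_tmul, m_comm c a, m_comm d b]
      abel

variable (k B)

/-- The comultiplication of `B^e`: `Δ m = (m ⊗ m) Δ` and `Δ h = (m ⊗ h + h ⊗ m) Δ`. -/
def comulHom : PoissonEnv k B →ₐ[k] PoissonEnv k B ⊗[k] PoissonEnv k B :=
  lift ((mm k B).comp (Bialgebra.comulAlgHom k B)) (mh k B ∘ₗ Coalgebra.comul)
    (fun x y => by
      simp only [LinearMap.comp_apply, PoissonBialgebra.comul_bracket, mh_bracket])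
    (fun x y => by
      simp [LinearMap.comp_apply, Bialgebra.comul_mul, mh_mul])
    (fun x y => by
      simp [PoissonBialgebra.comul_bracket, mm_bracket])

/-- The counit of `B^e`: `ε m = ε` and `ε h = 0`. -/
def counitHom : PoissonEnv k B →ₐ[k] k :=
  lift (Bialgebra.counitAlgHom k B) 0 (by simp) (by simp)
    (fun x y => by simp [PoissonBialgebra.counit_bracket])

variable {k B}

@[simp]
lemma comulHom_m (b : B) : comulHom k B (m k B b) = mm k B (Coalgebra.comul (R := k) b) := by
  simp [comulHom]

@[simp]
lemma comulHom_h (b : B) : comulHom k B (h k B b) = mh k B (Coalgebra.comul (R := k) b) := by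
  simp [comulHom]

@[simp]
lemma counitHom_m (b : B) : counitHom k B (m k B b) = Coalgebra.counit (R := k) b := by
  simp [counitHom]

@[simp]
lemma counitHom_h (b : B) : counitHom k B (h k B b) = 0 := by
  simp [counitHom]


lemma comul_coassoc :
    (Algebra.TensorProduct.assoc k k k _ _ _).toAlgHom.comp
      ((Algebra.TensorProduct.map (comulHom k B) (.id k _)).comp (comulHom k B)) =
    (Algebra.TensorProduct.map (.id k _) (comulHom k B)).comp (comulHom k B) := by
  refine hom_ext (fun a => ?_) (fun a => ?_)
  · let F : B ⊗[k] (B ⊗[k] B) →ₗ[k] PoissonEnv k B ⊗[k] (PoissonEnv k B ⊗[k] PoissonEnv k B) :=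
      TensorProduct.map (m k B).toLinearMap
        (TensorProduct.map (m k B).toLinearMap (m k B).toLinearMap)
    have h₁ : ∀ x : B ⊗[k] B,
        Algebra.TensorProduct.assoc k k k _ _ _
          (Algebra.TensorProduct.map (comulHom k B) (.id k _) (mm k B x)) =
        F (TensorProduct.assoc k B B B (LinearMap.rTensor B Coalgebra.comul x)) := by
      intro x
      induction x with
      | zero => simp
      | add x y hx hy => simp only [map_add, hx, hy]
      | tmul p q =>
        simp only [mm_tmul, Algebra.TensorProduct.map_tmul, comulHom_m, LinearMap.rTensor_tmul,
          AlgHom.id_apply]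
        induction Coalgebra.comul (R := k) p with
        | zero => simp
        | add x y hx hy => simp only [map_add, TensorProduct.add_tmul, hx, hy]
        | tmul r s => simp [F]
    have h₂ : ∀ x : B ⊗[k] B,
        Algebra.TensorProduct.map (.id k _) (comulHom k B) (mm k B x) =
        F (LinearMap.lTensor B Coalgebra.comul x) := by
      intro x
      induction x with
      | zero => simp
      | add x y hx hy => simp only [map_add, hx, hy]
      | tmul p q =>
        simp only [mm_tmul, Algebra.TensorProduct.map_tmul, comulHom_m, LinearMap.lTensor_tmul,
          AlgHom.id_apply]
        induction Coalgebra.comul (R := k) q with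
        | zero => simp
        | add x y hx hy => simp only [map_add, TensorProduct.tmul_add, hx, hy]
        | tmul r s => simp [F]
    have h₁' := h₁ (Coalgebra.comul (R := k) a)
    rw [Coalgebra.coassoc_apply, ← h₂] at h₁'
    simpa using h₁'
  · let F : B ⊗[k] (B ⊗[k] B) →ₗ[k] PoissonEnv k B ⊗[k] (PoissonEnv k B ⊗[k] PoissonEnv k B) :=
      TensorProduct.map (m k B).toLinearMap (mh k B) +
        TensorProduct.map (h k B) (mm k B).toLinearMap
    have h₁ : ∀ x : B ⊗[k] B,
        Algebra.TensorProduct.assoc k k k _ _ _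
          (Algebra.TensorProduct.map (comulHom k B) (.id k _) (mh k B x)) =
        F (TensorProduct.assoc k B B B (LinearMap.rTensor B Coalgebra.comul x)) := by
      intro x
      induction x with
      | zero => simp
      | add x y hx hy => simp only [map_add, hx, hy]
      | tmul p q =>
        simp only [mh_tmul, map_add, Algebra.TensorProduct.map_tmul, comulHom_m, comulHom_h,
          LinearMap.rTensor_tmul, AlgHom.id_apply]
        induction Coalgebra.comul (R := k) p with
        | zero => simp
        | add x y hx hy =>
          simp only [map_add, TensorProduct.add_tmul, ← hx, ← hy]
          abel
        | tmul r s => simp [F, TensorProduct.add_tmul, TensorProduct.tmul_add]; abel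
    have h₂ : ∀ x : B ⊗[k] B,
        Algebra.TensorProduct.map (.id k _) (comulHom k B) (mh k B x) =
        F (LinearMap.lTensor B Coalgebra.comul x) := by
      intro x
      induction x with
      | zero => simp
      | add x y hx hy => simp only [map_add, hx, hy]
      | tmul p q => simp [F]
    have h₁' := h₁ (Coalgebra.comul (R := k) a)
    rw [Coalgebra.coassoc_apply, ← h₂] at h₁'
    simpa using h₁'

lemma comul_rTensor :
    (Algebra.TensorProduct.map (counitHom k B) (.id k _)).comp (comulHom k B) =
      (Algebra.TensorProduct.lid k (PoissonEnv k B)).symm := by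
  refine hom_ext (fun a => ?_) (fun a => ?_)
  · have h₁ : ∀ x : B ⊗[k] B,
        Algebra.TensorProduct.map (counitHom k B) (.id k _) (mm k B x) =
        LinearMap.lTensor k (m k B).toLinearMap (LinearMap.rTensor B Coalgebra.counit x) := by
      intro x
      induction x with
      | zero => simp
      | add x y hx hy => simp only [map_add, hx, hy]
      | tmul p q => simp
    simpa using h₁ (Coalgebra.comul (R := k) a)
  · have h₁ : ∀ x : B ⊗[k] B,
        Algebra.TensorProduct.map (counitHom k B) (.id k _) (mh k B x) =
        LinearMap.lTensor k (h k B) (LinearMap.rTensor B Coalgebra.counit x) := by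
      intro x
      induction x with
      | zero => simp
      | add x y hx hy => simp only [map_add, hx, hy]
      | tmul p q => simp
    simpa using h₁ (Coalgebra.comul (R := k) a)

lemma comul_lTensor :
    (Algebra.TensorProduct.map (.id k _) (counitHom k B)).comp (comulHom k B) =
      (Algebra.TensorProduct.rid k k (PoissonEnv k B)).symm := by
  refine hom_ext (fun a => ?_) (fun a => ?_)
  · have h₁ : ∀ x : B ⊗[k] B,
        Algebra.TensorProduct.map (.id k _) (counitHom k B) (mm k B x) =
        LinearMap.rTensor k (m k B).toLinearMap (LinearMap.lTensor B Coalgebra.counit x) := by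
      intro x
      induction x with
      | zero => simp
      | add x y hx hy => simp only [map_add, hx, hy]
      | tmul p q => simp
    simpa using h₁ (Coalgebra.comul (R := k) a)
  · have h₁ : ∀ x : B ⊗[k] B,
        Algebra.TensorProduct.map (.id k _) (counitHom k B) (mh k B x) =
        LinearMap.rTensor k (h k B) (LinearMap.lTensor B Coalgebra.counit x) := by
      intro x
      induction x with
      | zero => simp
      | add x y hx hy => simp only [map_add, hx, hy]
      | tmul p q => simp
    simpa using h₁ (Coalgebra.comul (R := k) a)

instance : Bialgebra k (PoissonEnv k B) :=
  Bialgebra.ofAlgHom (comulHom k B) (counitHom k B) comul_coassoc comul_rTensor comul_lTensor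

lemma comul_apply (x : PoissonEnv k B) : Coalgebra.comul (R := k) x = comulHom k B x := rfl

lemma counit_apply (x : PoissonEnv k B) : Coalgebra.counit (R := k) x = counitHom k B x := rfl

end Bialgebra

/-! ### The quotient `H(B) = B^e / B^e B^+` -/

section Quotient

variable (k : Type u) (B : Type v) [Field k] [CommRing B] [Bialgebra k B] [PoissonBialgebra k B]

/-- The left ideal `B^e B^+` of `B^e`, where `B^+` is the kernel of the counit of `B`. -/
def augIdeal : Ideal (PoissonEnv k B) :=
  Ideal.span (m k B '' {b : B | Coalgebra.counit (R := k) b = 0})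

variable {k B}

lemma m_mem_augIdeal {b : B} (hb : Coalgebra.counit (R := k) b = 0) : m k B b ∈ augIdeal k B :=
  Ideal.subset_span ⟨b, hb, rfl⟩

/-- `B^e B^+` is a two-sided ideal. -/
instance : (augIdeal k B).IsTwoSided := by
  have key : ∀ y x : PoissonEnv k B, x ∈ augIdeal k B → x * y ∈ augIdeal k B := by
    intro y
    induction y using induction with
    | hm a =>
      intro x hx
      refine Submodule.span_induction (p := fun x _ => x * m k B a ∈ augIdeal k B)
        ?_ ?_ ?_ ?_ hx
      · rintro _ ⟨b, hb, rfl⟩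
        rw [m_comm]
        exact Ideal.mul_mem_left _ _ (m_mem_augIdeal hb)
      · simp
      · intro x y _ _ hx hy
        rw [add_mul]
        exact add_mem hx hy
      · intro r x _ hx
        rw [smul_eq_mul, mul_assoc]
        exact Ideal.mul_mem_left _ _ hx
    | hh a =>
      intro x hx
      refine Submodule.span_induction (p := fun x _ => x * h k B a ∈ augIdeal k B)
        ?_ ?_ ?_ ?_ hx
      · rintro _ ⟨b, hb, rfl⟩
        have : m k B b * h k B a = h k B a * m k B b - m k B (bracket (k := k) a b) := by
          rw [m_bracket]; abel
        rw [this]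
        exact sub_mem (Ideal.mul_mem_left _ _ (m_mem_augIdeal hb))
          (m_mem_augIdeal (PoissonBialgebra.counit_bracket k a b))
      · simp
      · intro x y _ _ hx hy
        rw [add_mul]
        exact add_mem hx hy
      · intro r x _ hx
        rw [smul_eq_mul, mul_assoc]
        exact Ideal.mul_mem_left _ _ hx
    | hadd y z hy hz =>
      intro x hx
      rw [mul_add]
      exact add_mem (hy x hx) (hz x hx)
    | hmul y z hy hz =>
      intro x hx
      rw [← mul_assoc]
      exact hz _ (hy x hx)
  exact ⟨fun {x} y hx => key y x hx⟩

lemma mk_m (b : B) : Ideal.Quotient.mk (augIdeal k B) (m k B b) =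
    algebraMap k _ (Coalgebra.counit (R := k) b) := by
  have h₁ : m k B (b - algebraMap k B (Coalgebra.counit (R := k) b)) ∈ augIdeal k B :=
    m_mem_augIdeal (by simp)
  rw [map_sub, AlgHom.commutes] at h₁
  exact Ideal.Quotient.eq.2 h₁

/-- `B^e B^+` is a coideal. -/
instance : ((augIdeal k B).restrictScalars k).IsCoideal where
  counit_eq_zero x hx := by
    have hle : augIdeal k B ≤ RingHom.ker (counitHom k B) := by
      refine Ideal.span_le.2 ?_
      rintro _ ⟨b, hb, rfl⟩
      simpa using hb
    exact hle hx
  map_mkQ_comul_eq_zero x hx := by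
    let q := Ideal.Quotient.mkₐ k (augIdeal k B)
    let F := (Algebra.TensorProduct.map q q).comp (comulHom k B)
    have hle : augIdeal k B ≤ RingHom.ker F := by
      refine Ideal.span_le.2 ?_
      rintro _ ⟨b, hb, rfl⟩
      have h₁ : ∀ x : B ⊗[k] B, Algebra.TensorProduct.map q q (mm k B x) =
          algebraMap k _ (Coalgebra.counit (R := k)
            (TensorProduct.lid k B (LinearMap.rTensor B Coalgebra.counit x))) := by
        intro x
        induction x with
        | zero => simp
        | add x y hx hy => simp only [map_add, hx, hy]
        | tmul c d =>
          simp only [q, mm_tmul, Algebra.TensorProduct.map_tmul, Ideal.Quotient.mkₐ_eq_mk, mk_m]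
          simp [Algebra.algebraMap_eq_smul_one, TensorProduct.smul_tmul',
            Algebra.TensorProduct.one_def, smul_smul, mul_comm]
      change F (m k B b) = 0
      simp only [F, AlgHom.comp_apply, comulHom_m, h₁]
      have hb' : Coalgebra.counit (R := k) b = 0 := hb
      simp [hb']
    exact hle hx

variable (k B)

/-- `H(B) = B^e / B^e B^+`. -/
def HQuot : Type (max u v) := PoissonEnv k B ⧸ augIdeal k B

instance : Ring (HQuot k B) := inferInstanceAs (Ring (PoissonEnv k B ⧸ augIdeal k B))

/-- The quotient bialgebra structure on `H(B)`. -/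
instance : Bialgebra k (HQuot k B) :=
  inferInstanceAs (Bialgebra k (PoissonEnv k B ⧸ augIdeal k B))

/-- The projection `π : B^e → H(B)`, a morphism of bialgebras. -/
def projBialg : PoissonEnv k B →ₐc[k] HQuot k B := Bialgebra.Quotient.mkBialgHom (augIdeal k B)

/-- The projection `π : B^e → H(B)` as an algebra map. -/
def proj : PoissonEnv k B →ₐ[k] HQuot k B := (projBialg k B : PoissonEnv k B →ₐ[k] HQuot k B)

/-- `θ = π ∘ h : B → H(B)`. -/
def theta : B →ₗ[k] HQuot k B := (proj k B).toLinearMap ∘ₗ h k B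

variable {k B}

lemma proj_m (b : B) : proj k B (m k B b) = algebraMap k _ (Coalgebra.counit (R := k) b) :=
  mk_m b

lemma proj_surjective : Function.Surjective (proj k B) := Ideal.Quotient.mk_surjective

lemma proj_eq_zero_iff (x : PoissonEnv k B) : proj k B x = 0 ↔ x ∈ augIdeal k B :=
  Ideal.Quotient.eq_zero_iff_mem

end Quotient

end PoissonEnv

/-! ## Right comodules, extensions and the normal basis property -/

/-- A right comodule structure on `M` over the coalgebra `C`. -/
structure RightComodule (k : Type u) (C : Type v) (M : Type w) [Field k] [AddCommGroup C]
    [Module k C] [Coalgebra k C] [AddCommGroup M] [Module k M] where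
  /-- The coaction `M → M ⊗ C`. -/
  coact : M →ₗ[k] M ⊗[k] C
  coassoc : (TensorProduct.assoc k M C C).toLinearMap ∘ₗ LinearMap.rTensor C coact ∘ₗ coact =
    LinearMap.lTensor M Coalgebra.comul ∘ₗ coact
  counit : (TensorProduct.rid k M).toLinearMap ∘ₗ LinearMap.lTensor M Coalgebra.counit ∘ₗ coact =
    LinearMap.id

namespace RightComodule

section General

variable {k : Type u} [Field k] {C : Type v} [AddCommGroup C] [Module k C] [Coalgebra k C]

/-- `f` is a morphism of right comodules: `(f ⊗ id) ρ = ρ' f`. -/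
def IsHom {M N : Type*} [AddCommGroup M] [Module k M] [AddCommGroup N] [Module k N]
    (ρ : RightComodule k C M) (ρ' : RightComodule k C N) (f : M →ₗ[k] N) : Prop :=
  LinearMap.rTensor C f ∘ₗ ρ.coact = ρ'.coact ∘ₗ f

variable (k C) in
/-- The right comodule `V ⊗ C` with coaction `id ⊗ Δ`. -/
def cofree (V : Type w) [AddCommGroup V] [Module k V] : RightComodule k C (V ⊗[k] C) where
  coact := (TensorProduct.assoc k V C C).symm.toLinearMap ∘ₗ LinearMap.lTensor V Coalgebra.comul
  coassoc := by
    ext v c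
    have h₁ : ∀ x : C ⊗[k] C,
        TensorProduct.assoc k (V ⊗[k] C) C C
          (LinearMap.rTensor C ((TensorProduct.assoc k V C C).symm.toLinearMap ∘ₗ
            LinearMap.lTensor V Coalgebra.comul) ((TensorProduct.assoc k V C C).symm (v ⊗ₜ[k] x))) =
        (TensorProduct.assoc k V C (C ⊗[k] C)).symm
          (v ⊗ₜ[k] TensorProduct.assoc k C C C (LinearMap.rTensor C Coalgebra.comul x)) := by
      intro x
      induction x with
      | zero => simp
      | add x y hx hy => simp only [map_add, TensorProduct.tmul_add, hx, hy]
      | tmul p q =>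
        simp only [TensorProduct.assoc_symm_tmul, LinearMap.rTensor_tmul, LinearMap.comp_apply,
          LinearMap.lTensor_tmul, LinearEquiv.coe_coe]
        induction Coalgebra.comul (R := k) p with
        | zero => simp
        | add x y hx hy => simp only [map_add, TensorProduct.tmul_add, TensorProduct.add_tmul, hx, hy]
        | tmul r s => simp
    have h₂ : ∀ x : C ⊗[k] C,
        LinearMap.lTensor (V ⊗[k] C) Coalgebra.comul
          ((TensorProduct.assoc k V C C).symm (v ⊗ₜ[k] x)) =
        (TensorProduct.assoc k V C (C ⊗[k] C)).symm
          (v ⊗ₜ[k] LinearMap.lTensor C Coalgebra.comul x) := by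
      intro x
      induction x with
      | zero => simp
      | add x y hx hy => simp only [map_add, TensorProduct.tmul_add, hx, hy]
      | tmul p q => simp
    have := h₁ (Coalgebra.comul (R := k) c)
    rw [Coalgebra.coassoc_apply, ← h₂] at this
    simpa using this
  counit := by
    ext v c
    have h₁ : ∀ x : C ⊗[k] C,
        TensorProduct.rid k (V ⊗[k] C) (LinearMap.lTensor (V ⊗[k] C) Coalgebra.counit
          ((TensorProduct.assoc k V C C).symm (v ⊗ₜ[k] x))) =
        v ⊗ₜ[k] TensorProduct.rid k C (LinearMap.lTensor C Coalgebra.counit x) := by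
      intro x
      induction x with
      | zero => simp
      | add x y hx hy => simp only [map_add, TensorProduct.tmul_add, hx, hy]
      | tmul p q => simp
    simpa using h₁ (Coalgebra.comul (R := k) c)

/-- A morphism `π : D → C` of coalgebras makes `D` a right `C`-comodule by `(id ⊗ π) Δ`. -/
def ofCoalgHom {D : Type w} [AddCommGroup D] [Module k D] [Coalgebra k D] (π : D →ₗc[k] C) :
    RightComodule k C D where
  coact := LinearMap.lTensor D π.toLinearMap ∘ₗ Coalgebra.comul
  coassoc := by
    ext u
    have h₁ : ∀ x : D ⊗[k] D,
        TensorProduct.assoc k _ _ _ (LinearMap.rTensor C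
          (LinearMap.lTensor D π.toLinearMap ∘ₗ Coalgebra.comul)
          (LinearMap.lTensor _ π.toLinearMap x)) =
        LinearMap.lTensor _ (TensorProduct.map π.toLinearMap π.toLinearMap)
          (TensorProduct.assoc k _ _ _ (LinearMap.rTensor _ Coalgebra.comul x)) := by
      intro x
      induction x with
      | zero => simp
      | add x y hx hy => simp only [map_add, hx, hy]
      | tmul p q =>
        simp only [LinearMap.lTensor_tmul, LinearMap.rTensor_tmul, LinearMap.comp_apply]
        induction Coalgebra.comul (R := k) p with
        | zero => simp
        | add x y hx hy => simp only [map_add, TensorProduct.add_tmul, hx, hy]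
        | tmul r s => simp
    have h₂ : ∀ x : D ⊗[k] D,
        LinearMap.lTensor _ Coalgebra.comul (LinearMap.lTensor _ π.toLinearMap x) =
        LinearMap.lTensor _ (TensorProduct.map π.toLinearMap π.toLinearMap)
          (LinearMap.lTensor _ Coalgebra.comul x) := by
      intro x
      induction x with
      | zero => simp
      | add x y hx hy => simp only [map_add, hx, hy]
      | tmul p q =>
        simp only [LinearMap.lTensor_tmul]
        exact congrArg (p ⊗ₜ[k] ·) (LinearMap.congr_fun π.map_comp_comul q).symm
    have := h₁ (Coalgebra.comul (R := k) u)
    rw [Coalgebra.coassoc_apply, ← h₂] at this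
    exact this
  counit := by
    rw [← LinearMap.comp_assoc _ _ (LinearMap.lTensor D Coalgebra.counit), ← LinearMap.lTensor_comp, π.counit_comp]
    ext u
    simp

end General

variable {k : Type u} [Field k] {H : Type v} [Ring H] [Bialgebra k H]
  {R A : Type*} [CommRing R] [Algebra k R] [Ring A] [Algebra k A]

/-- The coinvariants `A^{co H} = {a | ρ(a) = a ⊗ 1}`. -/
def coinvariants (ρ : RightComodule k H A) : Set A := {a | ρ.coact a = a ⊗ₜ[k] 1}

/-- `j : R → A` is a right `H`-extension: `A` is a right `H`-comodule algebra by `ρ`, and `j`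
identifies `R` with the coinvariants of `A`. -/
structure IsExtension (j : R →ₐ[k] A) (ρ : RightComodule k H A) : Prop where
  coact_one : ρ.coact 1 = 1
  coact_mul : ∀ a b : A, ρ.coact (a * b) = ρ.coact a * ρ.coact b
  injective : Function.Injective j
  range_eq : Set.range j = ρ.coinvariants

/-- `f : A → R ⊗ H` is an isomorphism of left `R`-modules and right `H`-comodules. Here `R` acts on
`A` through `j` and left multiplication, and on the left factor of `R ⊗ H`; the coaction on `R ⊗ H`
is `id ⊗ Δ`. -/
structure IsNormalBasisIso (j : R →ₐ[k] A) (ρ : RightComodule k H A)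
    (f : A →ₗ[k] R ⊗[k] H) : Prop where
  bijective : Function.Bijective f
  map_mul : ∀ (r : R) (a : A), f (j r * a) = r • f a
  isHom : IsHom ρ (cofree k H R) f

/-- The normal basis property of the extension `j : R → A`. -/
def HasNormalBasis (j : R →ₐ[k] A) (ρ : RightComodule k H A) : Prop :=
  ∃ f : A →ₗ[k] R ⊗[k] H, IsNormalBasisIso j ρ f

end RightComodule

namespace PoissonEnv

open PoissonAlgebra

section Upsilon

variable (k : Type u) (B : Type v) [Field k] [CommRing B]

section Base

variable [Algebra k B] [PoissonAlgebra k B]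

/-- The action of `B^e` on `B`: `m_a · b = a b` and `h_a · b = {a, b}`. -/
def act : PoissonEnv k B →ₐ[k] Module.End k B :=
  lift (Algebra.lmul k B) (bracket (k := k))
    (fun x y => by ext z; simpa using bracket_bracket k x y z)
    (fun x y => by
      ext z
      simp only [leibniz_left, LinearMap.add_apply, Module.End.mul_apply, Algebra.coe_lmul_eq_mul,
        LinearMap.mul_apply_apply]
      ring)
    (fun x y => by ext z; simp [leibniz])

/-- The `B^e`-module map `ξ : B^e → B`, `u ↦ u · 1`. -/
def xi : PoissonEnv k B →ₗ[k] B := LinearMap.applyₗ (1 : B) ∘ₗ (act k B).toLinearMap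

/-- The left ideal `I` of `B^e` generated by all `h_x`. -/
def derIdeal : Ideal (PoissonEnv k B) := Ideal.span (Set.range (h k B))

variable {k B}

@[simp]
lemma act_m (a b : B) : act k B (m k B a) b = a * b := by simp [act]

@[simp]
lemma act_h (a b : B) : act k B (h k B a) b = bracket (k := k) a b := by simp [act]

@[simp]
lemma xi_m (b : B) : xi k B (m k B b) = b := by simp [xi]

lemma xi_mul (u v : PoissonEnv k B) : xi k B (u * v) = act k B u (xi k B v) := by simp [xi]

/-- The projection to the second summand of `B^e = B ⊕ I`. -/
lemma sub_mem_derIdeal (u : PoissonEnv k B) : u - m k B (xi k B u) ∈ derIdeal k B := by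
  have hh : ∀ a, h k B a ∈ derIdeal k B := fun a => Ideal.subset_span ⟨a, rfl⟩
  have key : ∀ (u : PoissonEnv k B) (b : B),
      u * m k B b - m k B (act k B u b) ∈ derIdeal k B := by
    intro u
    induction u using induction with
    | hm a => intro b; simp
    | hh a =>
      intro b
      rw [act_h, m_bracket, sub_sub_cancel]
      exact Ideal.mul_mem_left _ _ (hh a)
    | hadd x y hx hy =>
      intro b
      have := add_mem (hx b) (hy b)
      simp only [add_mul, map_add, LinearMap.add_apply]
      convert this using 1
      abel
    | hmul x y hx hy =>
      intro b
      have := add_mem (Ideal.mul_mem_left _ x (hy b)) (hx (act k B y b))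
      simp only [map_mul, Module.End.mul_apply]
      convert this using 1
      noncomm_ring
  have := key u 1
  simpa [xi] using this

/-- `ξ` vanishes on `I`, so `B ∩ I = 0` and the sum `B + I` is direct. -/
lemma xi_eq_zero {u : PoissonEnv k B} (hu : u ∈ derIdeal k B) : xi k B u = 0 := by
  refine Submodule.span_induction (p := fun x _ => xi k B x = 0) ?_ ?_ ?_ ?_ hu
  · rintro _ ⟨a, rfl⟩
    simp [xi, bracket_one]
  · simp
  · intro x y _ _ hx hy
    simp [hx, hy]
  · intro r x _ hx
    simp [xi_mul, hx]

end Base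

variable [Bialgebra k B] [PoissonBialgebra k B]

/-- The action of `B^e` on `H(B)` by left multiplication through `π`. -/
def actH : PoissonEnv k B →ₐ[k] Module.End k (HQuot k B) := (Algebra.lmul k _).comp (proj k B)

/-- The action of `B^e` on `B ⊗ H(B)`, the tensor product of the `B^e`-modules `B` and `H(B)`
along the comultiplication of `B^e`. -/
def actBH : PoissonEnv k B →ₐ[k] Module.End k (B ⊗[k] HQuot k B) :=
  Module.endTensorEndAlgHom.comp
    ((Algebra.TensorProduct.map (act k B) (actH k B)).comp (Bialgebra.comulAlgHom k _))

/-- The Poisson derivation `p = (id ⊗ π h) Δ : B → B ⊗ H(B)`. -/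
def pDer : B →ₗ[k] B ⊗[k] HQuot k B := LinearMap.lTensor B (theta k B) ∘ₗ Coalgebra.comul

/-- The map `τ : I → B ⊗ H(B)`, `u ↦ u · (1 ⊗ 1)`. It is the unique `B^e`-module map with
`τ(h_x) = p(x)`, see `tau_h`, `tau_mul` and `tau_unique`. -/
def tau : derIdeal k B →ₗ[k] B ⊗[k] HQuot k B :=
  LinearMap.applyₗ ((1 : B) ⊗ₜ[k] (1 : HQuot k B)) ∘ₗ (actBH k B).toLinearMap ∘ₗ
    ((derIdeal k B).subtype.restrictScalars k)

variable {k B}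

lemma actBH_m (a : B) (z : B ⊗[k] HQuot k B) : actBH k B (m k B a) z = a • z := by
  have h₁ : ∀ (x : B ⊗[k] B) (b : B) (y : HQuot k B),
      Module.endTensorEndAlgHom (R := k) (S := k) (A := k) (M := B) (N := HQuot k B)
        (Algebra.TensorProduct.map (act k B) (actH k B) (mm k B x)) (b ⊗ₜ[k] y) =
      (TensorProduct.rid k B (LinearMap.lTensor B Coalgebra.counit x) * b) ⊗ₜ[k] y := by
    intro x b y
    induction x with
    | zero => simp
    | add x y hx hy =>
      simp only [map_add, LinearMap.add_apply, hx, hy, add_mul, TensorProduct.add_tmul]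
    | tmul p q =>
      have : proj k B (m k B q) = algebraMap k _ (Coalgebra.counit (R := k) q) :=
        proj_m q
      simp [actH, this, Module.endTensorEndAlgHom_apply, TensorProduct.smul_tmul',
        ← Algebra.smul_def]
  induction z with
  | zero => simp
  | add x y hx hy => simp only [map_add, hx, hy, smul_add]
  | tmul b y =>
    have := h₁ (Coalgebra.comul (R := k) a) b y
    rw [Coalgebra.lTensor_counit_comul] at this
    simpa [actBH, comul_apply, TensorProduct.smul_tmul'] using this

lemma tau_apply (u : derIdeal k B) : tau k B u = actBH k B u (1 ⊗ₜ[k] 1) := rfl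

lemma tau_h (x : B) : tau k B ⟨h k B x, Ideal.subset_span ⟨x, rfl⟩⟩ = pDer k B x := by
  have h₁ : ∀ x : B ⊗[k] B,
      Module.endTensorEndAlgHom (R := k) (S := k) (A := k) (M := B) (N := HQuot k B)
        (Algebra.TensorProduct.map (act k B) (actH k B) (mh k B x)) (1 ⊗ₜ[k] 1) =
      LinearMap.lTensor B (theta k B) x := by
    intro x
    induction x with
    | zero => simp
    | add x y hx hy => simp only [map_add, LinearMap.add_apply, hx, hy]
    | tmul p q => simp [actH, theta, bracket_one, Module.endTensorEndAlgHom_apply]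
  simpa [tau_apply, actBH, comul_apply, pDer] using h₁ (Coalgebra.comul (R := k) x)

lemma tau_mul (u : PoissonEnv k B) (v : derIdeal k B) :
    tau k B (u • v) = actBH k B u (tau k B v) := by
  simp [tau_apply]

lemma tau_unique (σ : derIdeal k B →ₗ[k] B ⊗[k] HQuot k B)
    (hσ : ∀ x, σ ⟨h k B x, Ideal.subset_span ⟨x, rfl⟩⟩ = pDer k B x)
    (hmul : ∀ u v, σ (u • v) = actBH k B u (σ v)) : σ = tau k B := by
  ext ⟨u, hu⟩
  refine Submodule.span_induction (p := fun u hu => σ ⟨u, hu⟩ = tau k B ⟨u, hu⟩) ?_ ?_ ?_ ?_ hu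
  · rintro _ ⟨x, rfl⟩
    rw [hσ, ← tau_h]
  · exact (map_zero σ).trans (map_zero (tau k B)).symm
  · intro x y hx hy h₁ h₂
    have h₃ := map_add σ ⟨x, hx⟩ ⟨y, hy⟩
    rw [h₁, h₂, ← map_add] at h₃
    exact h₃
  · intro r x hx h₁
    have h₂ := hmul r ⟨x, hx⟩
    rw [h₁, ← tau_mul] at h₂
    exact h₂

variable (k B)

/-- The projection `B^e → I`, `u ↦ u - m(ξ(u))`, along the decomposition `B^e = B ⊕ I`. -/
def projI : PoissonEnv k B →ₗ[k] derIdeal k B where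
  toFun u := ⟨u - m k B (xi k B u), sub_mem_derIdeal u⟩
  map_add' u v := by ext; simp only [map_add, Submodule.coe_add]; abel
  map_smul' c u := by
    ext
    simp [smul_sub]

/-- The map `ι : B → B ⊗ H(B)`, `b ↦ b ⊗ 1`. -/
def iotaB : B →ₗ[k] B ⊗[k] HQuot k B := (TensorProduct.mk k B (HQuot k B)).flip 1

/-- `Υ = ι ⊕ τ : B^e = B ⊕ I → B ⊗ H(B)`. -/
def upsilon : PoissonEnv k B →ₗ[k] B ⊗[k] HQuot k B :=
  iotaB k B ∘ₗ xi k B + tau k B ∘ₗ projI k B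

variable {k B}

lemma upsilon_m (b : B) : upsilon k B (m k B b) = b ⊗ₜ[k] 1 := by
  have : projI k B (m k B b) = 0 := by ext; simp [projI]
  simp [upsilon, this, iotaB]

lemma upsilon_of_mem {u : PoissonEnv k B} (hu : u ∈ derIdeal k B) :
    upsilon k B u = tau k B ⟨u, hu⟩ := by
  have : projI k B u = ⟨u, hu⟩ := by ext; simp [projI, xi_eq_zero hu]
  simp [upsilon, this, xi_eq_zero hu]

variable (k B)

/-- `B^e` as a right `H(B)`-comodule, with coaction `λ = (id ⊗ π) Δ`. -/
def comodule : RightComodule k (HQuot k B) (PoissonEnv k B) :=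
  RightComodule.ofCoalgHom (projBialg k B).toCoalgHom

end Upsilon

end PoissonEnv

end

noncomputable section

namespace PoissonEnv

open PoissonAlgebra

/-! ### `B` is a quotient `B^e`-module coalgebra of `B^e` -/

section ModuleCoalgebra

variable {k : Type u} {B : Type v} [Field k] [CommRing B] [Bialgebra k B] [PoissonBialgebra k B]

/-! The mechanism is the fundamental theorem of Hopf modules, applied to `B^e` over `B`.

The map `ξ(u) = u · 1` is a coalgebra map `B^e → B` (`comul_xi`, `counit_xi`), because `B` is a
module coalgebra over `B^e`, and it satisfies `ξ(m_b u) = b ξ(u)`. So left multiplication through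
`m` and the coaction `(ξ ⊗ id) Δ` make `B^e` a left Hopf module over the Hopf algebra `B`, hence
free over `B` on its left coinvariants. The projection onto these is `E(u) = m(S(ξ(u₁))) u₂`
(`coinvProj`). It satisfies `E(m_b u) = ε(b) E(u)`, so it kills the right ideal `B^+B^e`.

This right ideal contains the left ideal `B^eB^+` (`augIdeal_le_span`), since moving `h_a` past
`m_b` only produces `m_{{a,b}}`, and `ε({a,b}) = 0`. So `E` factors through `π` as `E = s π`.

On the other side, `Υ(u) = u · (1 ⊗ 1)`, that is, `Υ = (ξ ⊗ π) Δ` (`upsilon_eq`). This is the Hopf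
module isomorphism, with inverse `b ⊗ y ↦ m_b s(y)`; the two composites are controlled by
`mul'_xi_coinvProj` and `upsilon_coinvProj`. Colinearity is formal from `Υ = (ξ ⊗ id) λ`, and the
coinvariants are read off from injectivity of `Υ`. -/

variable (k B) in
/-- The diagonal action of `B^e` on `B ⊗ B`. -/
def actBB : PoissonEnv k B →ₐ[k] Module.End k (B ⊗[k] B) :=
  Module.endTensorEndAlgHom.comp
    ((Algebra.TensorProduct.map (act k B) (act k B)).comp (Bialgebra.comulAlgHom k _))

lemma actBB_m (a : B) (z : B ⊗[k] B) :
    actBB k B (m k B a) z = Coalgebra.comul (R := k) a * z := by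
  have key : ∀ x z : B ⊗[k] B, Module.endTensorEndAlgHom (R := k) (S := k) (A := k) (M := B)
      (N := B) (Algebra.TensorProduct.map (act k B) (act k B) (mm k B x)) z = x * z := by
    intro x z
    induction x with
    | zero => simp
    | add x y hx hy => simp only [map_add, LinearMap.add_apply, hx, hy, add_mul]
    | tmul p q =>
      induction z with
      | zero => simp
      | add x y hx hy => simp only [map_add, hx, hy, mul_add]
      | tmul r s => simp [Module.endTensorEndAlgHom_apply]
  simpa [actBB, comul_apply] using key (Coalgebra.comul (R := k) a) z

lemma actBB_h (a : B) (z : B ⊗[k] B) :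
    actBB k B (h k B a) z = tensorBracket k B (Coalgebra.comul (R := k) a) z := by
  have key : ∀ x z : B ⊗[k] B, Module.endTensorEndAlgHom (R := k) (S := k) (A := k) (M := B)
      (N := B) (Algebra.TensorProduct.map (act k B) (act k B) (mh k B x)) z =
      tensorBracket k B x z := by
    intro x z
    induction x with
    | zero => simp
    | add x y hx hy => simp only [map_add, LinearMap.add_apply, hx, hy]
    | tmul p q =>
      induction z with
      | zero => simp
      | add x y hx hy => simp only [map_add, hx, hy]
      | tmul r s => simp [Module.endTensorEndAlgHom_apply]
  simpa [actBB, comul_apply] using key (Coalgebra.comul (R := k) a) z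

/-- It suffices to test generators: for `m_a` this is multiplicativity of `Δ`, for `h_a` it is the
Poisson bialgebra axiom. Together with `counit_act` it makes `B` a module coalgebra over `B^e`. -/
lemma comul_act (u : PoissonEnv k B) (b : B) :
    Coalgebra.comul (R := k) (act k B u b) = actBB k B u (Coalgebra.comul (R := k) b) := by
  induction u using induction generalizing b with
  | hm a => rw [act_m, actBB_m, Bialgebra.comul_mul]
  | hh a => rw [act_h, actBB_h, PoissonBialgebra.comul_bracket]
  | hadd x y hx hy => simp only [map_add, LinearMap.add_apply, hx, hy]
  | hmul x y hx hy => simp only [map_mul, Module.End.mul_apply, hx, hy]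

lemma counit_act (u : PoissonEnv k B) (b : B) :
    Coalgebra.counit (R := k) (act k B u b) =
      Coalgebra.counit (R := k) u * Coalgebra.counit (R := k) b := by
  simp only [counit_apply]
  induction u using induction generalizing b with
  | hm a => simp
  | hh a => simp [PoissonBialgebra.counit_bracket]
  | hadd x y hx hy => simp only [map_add, LinearMap.add_apply, hx, hy, add_mul]
  | hmul x y hx hy => simp only [map_mul, Module.End.mul_apply, hx, hy, mul_assoc]

lemma counit_xi (u : PoissonEnv k B) :
    Coalgebra.counit (R := k) (xi k B u) = Coalgebra.counit (R := k) u := by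
  simpa [xi] using counit_act u (1 : B)

/-- `ξ` is a morphism of coalgebras. -/
lemma comul_xi (u : PoissonEnv k B) :
    Coalgebra.comul (R := k) (xi k B u) =
      TensorProduct.map (xi k B) (xi k B) (Coalgebra.comul (R := k) u) := by
  have key : ∀ x : PoissonEnv k B ⊗[k] PoissonEnv k B,
      Module.endTensorEndAlgHom (R := k) (S := k) (A := k) (M := B) (N := B)
        (Algebra.TensorProduct.map (act k B) (act k B) x) (1 ⊗ₜ[k] 1) =
      TensorProduct.map (xi k B) (xi k B) x := by
    intro x
    induction x with
    | zero => simp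
    | add x y hx hy => simp only [map_add, LinearMap.add_apply, hx, hy]
    | tmul p q => simp [Module.endTensorEndAlgHom_apply, xi]
  -- `ξ` is the orbit map of the group-like element `1`, and the orbit map of a group-like in a
  -- module coalgebra is a coalgebra map.
  have := comul_act u (1 : B)
  rw [Bialgebra.comul_one, Algebra.TensorProduct.one_def] at this
  exact this.trans (key _)

/-! ### `Υ` as the orbit map of `1 ⊗ 1`. -/

/-- The two pieces of `Υ` are restrictions of one map: `τ` is the action on `1 ⊗ 1` by definition,
and `m_b` acts as the scalar `b` on the left factor, so it sends `1 ⊗ 1` to `b ⊗ 1`. -/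
lemma upsilon_eq_actBH (u : PoissonEnv k B) : upsilon k B u = actBH k B u (1 ⊗ₜ[k] 1) := by
  simp only [upsilon, LinearMap.add_apply, LinearMap.comp_apply, tau_apply, projI,
    LinearMap.coe_mk, AddHom.coe_mk, map_sub, LinearMap.sub_apply, actBH_m, iotaB,
    LinearMap.flip_apply, TensorProduct.mk_apply, TensorProduct.smul_tmul', smul_eq_mul, mul_one,
    add_sub_cancel]

/-- `Υ = (ξ ⊗ π) Δ`. -/
lemma upsilon_eq (u : PoissonEnv k B) :
    upsilon k B u =
      TensorProduct.map (xi k B) (proj k B).toLinearMap (Coalgebra.comul (R := k) u) := by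
  have key : ∀ x : PoissonEnv k B ⊗[k] PoissonEnv k B,
      Module.endTensorEndAlgHom (R := k) (S := k) (A := k) (M := B) (N := HQuot k B)
        (Algebra.TensorProduct.map (act k B) (actH k B) x) (1 ⊗ₜ[k] 1) =
      TensorProduct.map (xi k B) (proj k B).toLinearMap x := by
    intro x
    induction x with
    | zero => simp
    | add x y hx hy => simp only [map_add, LinearMap.add_apply, hx, hy]
    | tmul p q => simp [Module.endTensorEndAlgHom_apply, xi, actH]
  exact (upsilon_eq_actBH u).trans (key _)

lemma upsilon_m_mul (b : B) (u : PoissonEnv k B) :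
    upsilon k B (m k B b * u) = b • upsilon k B u := by
  rw [upsilon_eq_actBH, upsilon_eq_actBH, map_mul, Module.End.mul_apply, actBH_m]

/-! ### The coaction `λ` and colinearity of `Υ`. -/

lemma m_injective : Function.Injective (m k B) :=
  Function.LeftInverse.injective (g := xi k B) xi_m

lemma comodule_coact (u : PoissonEnv k B) :
    (comodule k B).coact u =
      Algebra.TensorProduct.map (.id k _) (proj k B) (Coalgebra.comul (R := k) u) := rfl

lemma upsilon_eq_rTensor_coact (u : PoissonEnv k B) :
    upsilon k B u = LinearMap.rTensor _ (xi k B) ((comodule k B).coact u) := by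
  rw [upsilon_eq, comodule_coact]
  generalize (Coalgebra.comul (R := k) u) = x
  induction x with
  | zero => simp
  | add x y hx hy => simp only [map_add, hx, hy]
  | tmul p q => simp

/-- Since `π m` is the counit of `B`, applying `π` to the right leg of `(m ⊗ m) Δ(b)` leaves only
the counit axiom. -/
lemma coact_m (b : B) : (comodule k B).coact (m k B b) = m k B b ⊗ₜ[k] 1 := by
  have key : ∀ x : B ⊗[k] B, Algebra.TensorProduct.map (.id k _) (proj k B) (mm k B x) =
      m k B (TensorProduct.rid k B (LinearMap.lTensor B Coalgebra.counit x)) ⊗ₜ[k] 1 := by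
    intro x
    induction x with
    | zero => simp
    | add x y hx hy => simp only [map_add, hx, hy, TensorProduct.add_tmul]
    | tmul p q =>
      simp [proj_m, Algebra.algebraMap_eq_smul_one, TensorProduct.smul_tmul']
  rw [comodule_coact, comul_apply, comulHom_m, key]
  simp

/-- `Υ = (ξ ⊗ id) λ` is the comodule map into a cofree comodule that corresponds to the linear map
`ξ`. Only coassociativity of `λ` and linearity of `ξ` matter. -/
lemma upsilon_isHom : RightComodule.IsHom (comodule k B)
    (RightComodule.cofree k (HQuot k B) B) (upsilon k B) := by
  have hΥ : upsilon k B = LinearMap.rTensor _ (xi k B) ∘ₗ (comodule k B).coact :=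
    LinearMap.ext upsilon_eq_rTensor_coact
  have key : ∀ x : (PoissonEnv k B ⊗[k] HQuot k B) ⊗[k] HQuot k B,
      LinearMap.rTensor (HQuot k B) (LinearMap.rTensor (HQuot k B) (xi k B)) x =
      (TensorProduct.assoc k B (HQuot k B) (HQuot k B)).symm (LinearMap.rTensor _ (xi k B)
        (TensorProduct.assoc k _ _ _ x)) := by
    intro x
    induction x with
    | zero => simp
    | add x y hx hy => simp only [map_add, hx, hy]
    | tmul x r =>
      induction x with
      | zero => simp
      | add x y hx hy => simp only [map_add, TensorProduct.add_tmul, hx, hy]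
      | tmul p q => simp
  refine LinearMap.ext fun u => ?_
  have hassoc := LinearMap.congr_fun (comodule k B).coassoc u
  simp only [LinearMap.comp_apply, LinearEquiv.coe_coe] at hassoc
  rw [hΥ]
  simp only [LinearMap.comp_apply, LinearMap.rTensor_comp, key, hassoc, RightComodule.cofree,
    LinearEquiv.coe_coe]
  generalize (comodule k B).coact u = x
  -- What remains is that `ξ ⊗ id` and `id ⊗ Δ` act on different legs and so commute.
  rw [← LinearMap.comp_apply, ← LinearMap.comp_apply, LinearMap.lTensor_comp_rTensor,
    LinearMap.rTensor_comp_lTensor]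

end ModuleCoalgebra

/-! ### The fundamental theorem of Hopf modules for `B^e` -/

section HopfModule

variable {k : Type u} {B : Type v} [Field k] [CommRing B] [HopfAlgebra k B] [PoissonBialgebra k B]

variable (k B) in
/-- The projection `u ↦ m(S(ξ(u₁))) u₂` of `B^e` onto the left `B`-coinvariants. -/
def coinvProj : PoissonEnv k B →ₗ[k] PoissonEnv k B :=
  LinearMap.mul' k _ ∘ₗ
    LinearMap.rTensor _ ((m k B).toLinearMap ∘ₗ HopfAlgebra.antipode k ∘ₗ xi k B) ∘ₗ
      Coalgebra.comul

/-- Expanding gives `m(S(b₁ ξ(u₁))) m(b₂) u₂`. As `B` is commutative, `S` is multiplicative and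
`m(b₂)` can be moved next to `m(S(b₁))`, where the antipode axiom yields `ε(b)`. -/
lemma coinvProj_m_mul (b : B) (u : PoissonEnv k B) :
    coinvProj k B (m k B b * u) = Coalgebra.counit (R := k) b • coinvProj k B u := by
  have key : ∀ (x : B ⊗[k] B) (y : PoissonEnv k B ⊗[k] PoissonEnv k B),
      LinearMap.mul' k _ (LinearMap.rTensor _
        ((m k B).toLinearMap ∘ₗ HopfAlgebra.antipode k ∘ₗ xi k B) (mm k B x * y)) =
      m k B (LinearMap.mul' k _ (LinearMap.rTensor _ (HopfAlgebra.antipode k) x)) *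
        LinearMap.mul' k _ (LinearMap.rTensor _
          ((m k B).toLinearMap ∘ₗ HopfAlgebra.antipode k ∘ₗ xi k B) y) := by
    intro x y
    induction x with
    | zero => simp
    | add x₁ x₂ h₁ h₂ => simp only [map_add, add_mul, h₁, h₂]
    | tmul p q =>
      induction y with
      | zero => simp
      | add y₁ y₂ h₁ h₂ => simp only [map_add, mul_add, h₁, h₂]
      | tmul r s =>
        simp only [mm_tmul, Algebra.TensorProduct.tmul_mul_tmul, LinearMap.rTensor_tmul,
          LinearMap.comp_apply, LinearMap.mul'_apply, xi_mul, act_m,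
          HopfAlgebra.antipode_mul_distrib, AlgHom.toLinearMap_apply, map_mul]
        rw [mul_assoc, mul_assoc, ← mul_assoc (m k B q), m_comm q, mul_assoc]
  simp only [coinvProj, LinearMap.comp_apply, Bialgebra.comul_mul]
  rw [comul_apply (m k B b), comulHom_m, key, HopfAlgebra.mul_antipode_rTensor_comul_apply,
    AlgHom.commutes, ← Algebra.smul_def]

/-! ### Factoring the projection through `H(B)`. -/

/-- Reconciles two sides: `H(B)` is a quotient by a left ideal, whereas `coinvProj_m_mul` controls
elements with `B^+` on the left. The span contains `m(B^+)`, so the point is its stability under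
left multiplication. For `h_a` this is `h_a m_b = m_b h_a + m_{{a,b}}` together with `ε({a,b}) = 0`.
-/
lemma augIdeal_le_span : (augIdeal k B : Set (PoissonEnv k B)) ⊆
    Submodule.span k {x | ∃ (b : B) (v : PoissonEnv k B),
      Coalgebra.counit (R := k) b = 0 ∧ x = m k B b * v} := by
  set K := Submodule.span k {x : PoissonEnv k B | ∃ (b : B) (v : PoissonEnv k B),
      Coalgebra.counit (R := k) b = 0 ∧ x = m k B b * v}
  have hK : ∀ (b : B) (v : PoissonEnv k B), Coalgebra.counit (R := k) b = 0 → m k B b * v ∈ K :=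
    fun b v hb => Submodule.subset_span ⟨b, v, hb, rfl⟩
  have of_gen : ∀ u : PoissonEnv k B,
      (∀ (b : B) (v : PoissonEnv k B), Coalgebra.counit (R := k) b = 0 → u * (m k B b * v) ∈ K) →
      ∀ x ∈ K, u * x ∈ K := by
    intro u hu x hx
    refine Submodule.span_induction (p := fun x _ => u * x ∈ K) ?_ ?_ ?_ ?_ hx
    · rintro _ ⟨b, v, hb, rfl⟩
      exact hu b v hb
    · simp
    · intro x y _ _ h₁ h₂
      rw [mul_add]
      exact add_mem h₁ h₂
    · intro c x _ h₁
      rw [mul_smul_comm]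
      exact K.smul_mem c h₁
  have hmul : ∀ u x : PoissonEnv k B, x ∈ K → u * x ∈ K := by
    intro u
    induction u using induction with
    | hm a =>
      refine of_gen _ fun b v hb => ?_
      rw [← mul_assoc, ← map_mul]
      exact hK _ _ (by simp [hb])
    | hh a =>
      refine of_gen _ fun b v hb => ?_
      rw [← mul_assoc, h_comm_m, add_mul, mul_assoc]
      exact add_mem (hK _ _ hb) (hK _ _ (PoissonBialgebra.counit_bracket k a b))
    | hadd x y hx hy =>
      intro z hz
      rw [add_mul]
      exact add_mem (hx z hz) (hy z hz)
    | hmul x y hx hy =>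
      intro z hz
      rw [mul_assoc]
      exact hx _ (hy z hz)
  intro x hx
  refine Submodule.span_induction (p := fun x _ => x ∈ K) ?_ K.zero_mem ?_ ?_ hx
  · rintro _ ⟨b, hb, rfl⟩
    simpa using hK b 1 hb
  · intro x y _ _ h₁ h₂
    exact add_mem h₁ h₂
  · intro r x _ h₁
    exact hmul r x h₁

lemma coinvProj_eq_zero {u : PoissonEnv k B} (hu : u ∈ augIdeal k B) : coinvProj k B u = 0 := by
  refine Submodule.span_induction (p := fun x _ => coinvProj k B x = 0) ?_ ?_ ?_ ?_
    (augIdeal_le_span hu)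
  · rintro _ ⟨b, v, hb, rfl⟩
    rw [coinvProj_m_mul, hb, zero_smul]
  · simp
  · intro x y _ _ hx hy
    rw [map_add, hx, hy, add_zero]
  · intro c x _ hx
    rw [map_smul, hx, smul_zero]

/-- Supplies the map `s` on `H(B)` from which the inverse of `Υ` is built. -/
lemma exists_coinvProj_lift :
    ∃ s : HQuot k B →ₗ[k] PoissonEnv k B, ∀ u, s (proj k B u) = coinvProj k B u := by
  let p := (proj k B).toLinearMap
  have hp : Function.Surjective p := proj_surjective
  have hker : LinearMap.ker p ≤ LinearMap.ker (coinvProj k B) := fun u hu =>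
    coinvProj_eq_zero ((proj_eq_zero_iff u).1 hu)
  refine ⟨(LinearMap.ker p).liftQ _ hker ∘ₗ (p.quotKerEquivOfSurjective hp).symm.toLinearMap,
    fun u => ?_⟩
  have : (p.quotKerEquivOfSurjective hp).symm (p u) = Submodule.Quotient.mk u := by
    rw [LinearEquiv.symm_apply_eq]
    rfl
  change (LinearMap.ker p).liftQ _ hker ((p.quotKerEquivOfSurjective hp).symm (p u)) = _
  rw [this]
  rfl

/-! ### Convolution identities and bijectivity of `Υ`. -/

/-- Because `ξ` is a coalgebra map, the antipode axioms of `B` pull back along it: `S ξ` is a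
convolution inverse of `ξ` in `Hom(B^e, B)`. This is the left inverse law; `mul'_xi_antipode_comul`
is the right one. -/
lemma mul'_antipode_xi_comul (u : PoissonEnv k B) :
    LinearMap.mul' k B (TensorProduct.map (HopfAlgebra.antipode k ∘ₗ xi k B) (xi k B)
      (Coalgebra.comul (R := k) u)) = algebraMap k B (Coalgebra.counit (R := k) u) := by
  have : TensorProduct.map (HopfAlgebra.antipode k ∘ₗ xi k B) (xi k B) =
      LinearMap.rTensor B (HopfAlgebra.antipode k) ∘ₗ TensorProduct.map (xi k B) (xi k B) := by
    rw [LinearMap.rTensor_comp_map]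
  rw [this, LinearMap.comp_apply, ← comul_xi, HopfAlgebra.mul_antipode_rTensor_comul_apply,
    counit_xi]

lemma mul'_xi_antipode_comul (u : PoissonEnv k B) :
    LinearMap.mul' k B (TensorProduct.map (xi k B) (HopfAlgebra.antipode k ∘ₗ xi k B)
      (Coalgebra.comul (R := k) u)) = algebraMap k B (Coalgebra.counit (R := k) u) := by
  have : TensorProduct.map (xi k B) (HopfAlgebra.antipode k ∘ₗ xi k B) =
      LinearMap.lTensor B (HopfAlgebra.antipode k) ∘ₗ TensorProduct.map (xi k B) (xi k B) := by
    rw [LinearMap.lTensor_comp_map]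
  rw [this, LinearMap.comp_apply, ← comul_xi, HopfAlgebra.mul_antipode_lTensor_comul_apply,
    counit_xi]

/-- By left `B`-linearity and `Υ = (ξ ⊗ π) Δ`, the left side is `S(ξ(u₁)) ξ(u₂) ⊗ π(u₃)`, and the
first two factors cancel by convolution. This gives surjectivity. -/
lemma upsilon_coinvProj (u : PoissonEnv k B) :
    upsilon k B (coinvProj k B u) = 1 ⊗ₜ[k] proj k B u := by
  let S : PoissonEnv k B →ₗ[k] B := HopfAlgebra.antipode k ∘ₗ xi k B
  let P := (proj k B).toLinearMap
  let F : PoissonEnv k B ⊗[k] PoissonEnv k B →ₗ[k] B :=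
    LinearMap.mul' k B ∘ₗ TensorProduct.map S (xi k B)
  -- `G` sends `p ⊗ (r ⊗ s)` to `S(ξ(p)) ξ(r) ⊗ π(s)`; the inverse associator groups the two legs
  -- that are to cancel.
  let G := TensorProduct.map F P ∘ₗ
    (TensorProduct.assoc k (PoissonEnv k B) (PoissonEnv k B) (PoissonEnv k B)).symm.toLinearMap
  have hG : ∀ (p : PoissonEnv k B) (y : PoissonEnv k B ⊗[k] PoissonEnv k B),
      S p • TensorProduct.map (xi k B) P y = G (p ⊗ₜ[k] y) := by
    intro p y
    induction y with
    | zero => simp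
    | add x y hx hy => simp only [map_add, smul_add, TensorProduct.tmul_add, hx, hy]
    | tmul r s => simp [G, F, TensorProduct.smul_tmul']
  have h₁ : ∀ x : PoissonEnv k B ⊗[k] PoissonEnv k B,
      upsilon k B (LinearMap.mul' k _ (LinearMap.rTensor _ ((m k B).toLinearMap ∘ₗ S) x)) =
        G (LinearMap.lTensor _ Coalgebra.comul x) := by
    intro x
    induction x with
    | zero => simp
    | add x y hx hy => simp only [map_add, hx, hy]
    | tmul p q =>
      rw [LinearMap.lTensor_tmul, ← hG, ← upsilon_eq, ← upsilon_m_mul]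
      rfl
  have h₂ : ∀ x : PoissonEnv k B ⊗[k] PoissonEnv k B,
      TensorProduct.map F P (LinearMap.rTensor _ Coalgebra.comul x) =
        TensorProduct.map (Algebra.linearMap k B) P (LinearMap.rTensor _ Coalgebra.counit x) := by
    intro x
    induction x with
    | zero => simp
    | add x y hx hy => simp only [map_add, hx, hy]
    | tmul p q =>
      simp only [LinearMap.rTensor_tmul, TensorProduct.map_tmul]
      congr 1
      exact mul'_antipode_xi_comul p
  refine (h₁ (Coalgebra.comul (R := k) u)).trans ?_
  -- After coassociativity the first two legs come from a single `Δ`, to which `h₂` applies.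
  rw [← Coalgebra.coassoc_apply]
  simp only [G, LinearMap.comp_apply, LinearEquiv.coe_coe, LinearEquiv.symm_apply_apply, h₂,
    Coalgebra.rTensor_counit_comul, TensorProduct.map_tmul, Algebra.linearMap_apply, map_one]
  rfl

/-- Every element is recovered from its projection: `m(ξ(u₁)) m(S(ξ(u₂))) u₃ = u`, by the right
inverse law for `ξ` and the counit axiom. This gives injectivity. -/
lemma mul'_xi_coinvProj (u : PoissonEnv k B) :
    LinearMap.mul' k _ (TensorProduct.map ((m k B).toLinearMap ∘ₗ xi k B) (coinvProj k B)
      (Coalgebra.comul (R := k) u)) = u := by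
  let S : PoissonEnv k B →ₗ[k] B := HopfAlgebra.antipode k ∘ₗ xi k B
  let F : PoissonEnv k B ⊗[k] PoissonEnv k B →ₗ[k] B :=
    LinearMap.mul' k B ∘ₗ TensorProduct.map (xi k B) S
  let G := LinearMap.mul' k _ ∘ₗ LinearMap.rTensor (PoissonEnv k B) ((m k B).toLinearMap ∘ₗ F) ∘ₗ
    (TensorProduct.assoc k (PoissonEnv k B) (PoissonEnv k B) (PoissonEnv k B)).symm.toLinearMap
  have hG : ∀ (p : PoissonEnv k B) (y : PoissonEnv k B ⊗[k] PoissonEnv k B),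
      m k B (xi k B p) * LinearMap.mul' k _ (LinearMap.rTensor _ ((m k B).toLinearMap ∘ₗ S) y) =
        G (p ⊗ₜ[k] y) := by
    intro p y
    induction y with
    | zero => simp
    | add x y hx hy => simp only [map_add, mul_add, TensorProduct.tmul_add, hx, hy]
    | tmul r s => simp [G, F, mul_assoc]
  have h₁ : ∀ x : PoissonEnv k B ⊗[k] PoissonEnv k B,
      LinearMap.mul' k _ (TensorProduct.map ((m k B).toLinearMap ∘ₗ xi k B) (coinvProj k B) x) =
        G (LinearMap.lTensor _ Coalgebra.comul x) := by
    intro x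
    induction x with
    | zero => simp
    | add x y hx hy => simp only [map_add, hx, hy]
    | tmul p q =>
      rw [LinearMap.lTensor_tmul, ← hG]
      rfl
  have h₂ : ∀ x : PoissonEnv k B ⊗[k] PoissonEnv k B,
      LinearMap.rTensor (PoissonEnv k B) ((m k B).toLinearMap ∘ₗ F)
          (LinearMap.rTensor _ Coalgebra.comul x) =
        LinearMap.rTensor (PoissonEnv k B) ((m k B).toLinearMap ∘ₗ Algebra.linearMap k B)
          (LinearMap.rTensor _ Coalgebra.counit x) := by
    intro x
    induction x with
    | zero => simp
    | add x y hx hy => simp only [map_add, hx, hy]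
    | tmul p q =>
      simp only [LinearMap.rTensor_tmul]
      congr 1
      exact congrArg (m k B) (mul'_xi_antipode_comul p)
  rw [h₁, ← Coalgebra.coassoc_apply]
  simp only [G, LinearMap.comp_apply, LinearEquiv.coe_coe, LinearEquiv.symm_apply_apply, h₂,
    Coalgebra.rTensor_counit_comul, LinearMap.rTensor_tmul, Algebra.linearMap_apply, map_one,
    LinearMap.mul'_apply, AlgHom.toLinearMap_apply, one_mul]

lemma upsilon_injective : Function.Injective (upsilon k B) := by
  obtain ⟨s, hs⟩ := exists_coinvProj_lift (k := k) (B := B)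
  refine Function.LeftInverse.injective
    -- The left inverse is `b ⊗ y ↦ m_b s(y)`; since `s π` is `coinvProj`, composing it with `(ξ ⊗
    -- π) Δ` gives the expression in `mul'_xi_coinvProj`.
    (g := LinearMap.mul' k _ ∘ₗ TensorProduct.map (m k B).toLinearMap s) fun u => ?_
  have hs' : s ∘ₗ (proj k B).toLinearMap = coinvProj k B := LinearMap.ext hs
  rw [upsilon_eq, LinearMap.comp_apply, ← LinearMap.comp_apply (TensorProduct.map _ _),
    ← TensorProduct.map_comp, hs', mul'_xi_coinvProj]

lemma upsilon_surjective : Function.Surjective (upsilon k B) := by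
  intro z
  induction z with
  | zero => exact ⟨0, map_zero _⟩
  | add x y hx hy =>
    obtain ⟨u, rfl⟩ := hx
    obtain ⟨v, rfl⟩ := hy
    exact ⟨u + v, map_add _ _ _⟩
  | tmul b y =>
    obtain ⟨u, rfl⟩ := proj_surjective y
    refine ⟨m k B b * coinvProj k B u, ?_⟩
    rw [upsilon_m_mul, upsilon_coinvProj, TensorProduct.smul_tmul', smul_eq_mul, mul_one]

/-! ### Coinvariants and the final assembly. -/

/-- If `λ(u) = u ⊗ 1`, applying `ξ ⊗ id` gives `Υ(u) = ξ(u) ⊗ 1 = Υ(m(ξ(u)))`, and injectivity of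
`Υ` forces `u = m(ξ(u))`. -/
lemma coinvariants_eq : Set.range (m k B) = (comodule k B).coinvariants := by
  refine Set.Subset.antisymm (Set.range_subset_iff.2 coact_m) fun u hu => ⟨xi k B u, ?_⟩
  have hu' : (comodule k B).coact u = u ⊗ₜ[k] 1 := hu
  refine upsilon_injective ?_
  rw [upsilon_m, upsilon_eq_rTensor_coact, hu', LinearMap.rTensor_tmul]

lemma upsilon_isNormalBasisIso :
    RightComodule.IsNormalBasisIso (m k B) (comodule k B) (upsilon k B) where
  bijective := ⟨upsilon_injective, upsilon_surjective⟩
  map_mul := upsilon_m_mul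
  isHom := upsilon_isHom

lemma m_isExtension : RightComodule.IsExtension (m k B) (comodule k B) where
  coact_one := by rw [comodule_coact, Bialgebra.comul_one, map_one]
  coact_mul a b := by simp only [comodule_coact, Bialgebra.comul_mul, map_mul]
  injective := m_injective
  range_eq := coinvariants_eq

end HopfModule

end PoissonEnv

end

theorem mainTheorem2 {k : Type u} [Field k] {B : Type v} [CommRing B] [HopfAlgebra k B]
    [PoissonBialgebra k B] (hB : PointedCoalgebra.IsPointed k B) :
    RightComodule.IsExtension (PoissonEnv.m k B) (PoissonEnv.comodule k B) ∧
    RightComodule.HasNormalBasis (PoissonEnv.m k B) (PoissonEnv.comodule k B) ∧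
    RightComodule.IsNormalBasisIso (PoissonEnv.m k B) (PoissonEnv.comodule k B)
      (PoissonEnv.upsilon k B) := by
  exact ⟨PoissonEnv.m_isExtension, ⟨_, PoissonEnv.upsilon_isNormalBasisIso⟩,
    PoissonEnv.upsilon_isNormalBasisIso⟩
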